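/- Let $H=\mathbb Z^2\rtimes\mathbb Z$ be the discrete Heisenberg group, i.e. the set of triples $((m,k),s)$ of integers with multiplication $((m,k),s)*((m',k'),s')=((m+m',\,k+k'+sm'),\,s+s')$, and let $p\ge 1$ be an integer. For every irreducible unitary representation $\rho$ of $H$ on a $p$-dimensional complex Hilbert space $V$ there are numbers $\xi,\eta,\alpha\in[0,1)$, where $\eta=q/p$ is an irreducible fraction with denominator $p$, and an orthonormal basis $\epsilon_0,\dots,\epsilon_{p-1}$ of $V$ such that for all $m,k,s\in\mathbb Z$ and $0\le j\le p-1$ $$\rho((m,k),s)\,\epsilon_j=e^{2\pi i\left(m\xi+(k+j'm)\eta+\left[\frac{s+j'}{p}\right]\alpha\right)}\,\epsilon_{j'},\qquad j'=(j-s)\bmod p\in\{0,\dots,p-1\},\tag{2}$$ where $[\cdot]$ denotes the integer part (floor). Moreover, let $\rho$ be any unitary representation of $H$ on a $p$-dimensional space that has the form (2) in some orthonormal basis, with $\xi,\eta,\alpha\in[0,1)$ and $\eta=q/p$ an irreducible fraction with denominator $p$. Then $\rho$ is unitarily equivalent to the representation $\mathrm{Ind}(H,Y,\beta)$ induced from the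 character $\beta((m,k),ps)=e^{2\pi i(m\xi+k\eta+s\alpha)}$ of the subgroup $Y=\mathbb Z^2\rtimes p\mathbb Z=\{((m,k),ps)\mid m,k,s\in\mathbb Z\}$. Here, for any section $t:Y\backslash H\to H$ with $t(Yg)\in Yg$, $\mathrm{Ind}(H,Y,\beta)$ is the representation on $L^2(Y\backslash H)$ given by $[\mathrm{Ind}(h)f](x)=\beta(y)f(xh)$, with $y\in Y$ determined by $t(x)h=y\,t(xh)$. The character (trace) of $\rho$ is $$\chi_\rho((m,k),s)=\begin{cases}p\,e^{2\pi i\left(m\xi+k\eta+\frac sp\alpha\right)},&\text{if } s\equiv 0\ (\mathrm{mod}\ p)\text{ and } m\equiv0\ (\mathrm{mod}\ p),\\ 0&\text{otherwise.}\end{cases}$$ -/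

import Mathlib

noncomputable section

/-- The discrete Heisenberg group `H = ℤ² ⋊ ℤ`: triples `((m, k), s)` of integers, where `s ∈ ℤ`
acts on `ℤ²` by `(m, k) ↦ (m, k + s m)`. -/
@[ext]
structure DiscreteHeisenberg where
  m : ℤ
  k : ℤ
  s : ℤ

namespace DiscreteHeisenberg

/-- `((m, k), s) * ((m', k'), s') = ((m + m', k + k' + s m'), s + s')`. -/
instance : Mul DiscreteHeisenberg :=
  ⟨fun g h => ⟨g.m + h.m, g.k + h.k + g.s * h.m, g.s + h.s⟩⟩

instance : One DiscreteHeisenberg := ⟨⟨0, 0, 0⟩⟩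

/-- `((m, k), s)⁻¹ = ((-m, s m - k), -s)`. -/
instance : Inv DiscreteHeisenberg := ⟨fun g => ⟨-g.m, g.s * g.m - g.k, -g.s⟩⟩

@[simp] theorem mul_m (g h : DiscreteHeisenberg) : (g * h).m = g.m + h.m := rfl
@[simp] theorem mul_k (g h : DiscreteHeisenberg) : (g * h).k = g.k + h.k + g.s * h.m := rfl
@[simp] theorem mul_s (g h : DiscreteHeisenberg) : (g * h).s = g.s + h.s := rfl
@[simp] theorem one_m : (1 : DiscreteHeisenberg).m = 0 := rfl
@[simp] theorem one_k : (1 : DiscreteHeisenberg).k = 0 := rfl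
@[simp] theorem one_s : (1 : DiscreteHeisenberg).s = 0 := rfl
@[simp] theorem inv_m (g : DiscreteHeisenberg) : (g⁻¹).m = -g.m := rfl
@[simp] theorem inv_k (g : DiscreteHeisenberg) : (g⁻¹).k = g.s * g.m - g.k := rfl
@[simp] theorem inv_s (g : DiscreteHeisenberg) : (g⁻¹).s = -g.s := rfl

instance : Group DiscreteHeisenberg :=
  Group.ofLeftAxioms
    (fun a b c => by ext <;> simp <;> ring)
    (fun a => by ext <;> simp)
    (fun a => by ext <;> simp)

end DiscreteHeisenberg

/-- A unitary representation of a (discrete) group `G` on an inner product space `V`: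
a homomorphism from `G` to the group of surjective linear isometries of `V`. -/
abbrev UnitaryRep (G V : Type*) [Group G] [NormedAddCommGroup V] [InnerProductSpace ℂ V] :=
  G →* (V ≃ₗᵢ[ℂ] V)

namespace UnitaryRep

variable {G V W : Type*} [Group G] [NormedAddCommGroup V] [InnerProductSpace ℂ V]
  [NormedAddCommGroup W] [InnerProductSpace ℂ W]

/-- The underlying linear representation. -/
def toRepresentation (ρ : UnitaryRep G V) : Representation ℂ G V where
  toFun g := (ρ g).toLinearEquiv.toLinearMap
  map_one' := by rw [map_one]; rfl
  map_mul' g h := by rw [map_mul]; rfl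

/-- Unitary equivalence: an isometric isomorphism that intertwines the two representations. -/
def UnitarilyEquivalent (ρ : UnitaryRep G V) (σ : UnitaryRep G W) : Prop :=
  ∃ U : V ≃ₗᵢ[ℂ] W, ∀ (g : G) (v : V), U (ρ g v) = σ g (U v)

/-- The one-dimensional unitary representation given by a unitary character. -/
def ofCharacter (χ : G →* Circle) : UnitaryRep G ℂ where
  toFun g :=
    { toFun := fun z => (χ g : ℂ) * z
      invFun := fun z => (χ g⁻¹ : ℂ) * z
      map_add' := fun z w => mul_add _ z w
      map_smul' := fun c z => by simp only [smul_eq_mul, RingHom.id_apply]; ring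
      left_inv := fun z => by
        change (χ g⁻¹ : ℂ) * ((χ g : ℂ) * z) = z
        rw [← mul_assoc, ← Circle.coe_mul, ← map_mul, inv_mul_cancel, map_one, Circle.coe_one,
          one_mul]
      right_inv := fun z => by
        change (χ g : ℂ) * ((χ g⁻¹ : ℂ) * z) = z
        rw [← mul_assoc, ← Circle.coe_mul, ← map_mul, mul_inv_cancel, map_one, Circle.coe_one,
          one_mul]
      norm_map' := fun z => by
        change ‖(χ g : ℂ) * z‖ = ‖z‖
        rw [norm_mul, Circle.norm_coe, one_mul] }
  map_one' := by
    ext z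
    change ((χ 1 : Circle) : ℂ) * z = z
    rw [map_one, Circle.coe_one, one_mul]
  map_mul' g h := by
    ext z
    change ((χ (g * h) : Circle) : ℂ) * z = (χ g : ℂ) * ((χ h : ℂ) * z)
    rw [map_mul, Circle.coe_mul, mul_assoc]

end UnitaryRep

/-! ### Induced unitary representations of discrete groups -/

/-- The right homogeneous space `X = Y \ G` of right cosets `Y g`. -/
abbrev RightCosets {G : Type*} [Group G] (Y : Subgroup G) : Type _ :=
  Quotient (QuotientGroup.rightRel Y)

namespace RightCosets

variable {G : Type*} [Group G] {Y : Subgroup G}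

/-- The right action of `G` on `Y \ G`: `(Y g) h = Y (g h)`. -/
def act (x : RightCosets Y) (h : G) : RightCosets Y :=
  Quotient.map' (fun g => g * h) (fun a b hab => by
    rw [QuotientGroup.rightRel_apply] at hab ⊢
    simpa [mul_assoc] using hab) x

theorem act_one (x : RightCosets Y) : x.act 1 = x := by
  induction x using Quotient.inductionOn' with
  | h g => exact congrArg Quotient.mk'' (mul_one g)

theorem act_act (x : RightCosets Y) (g h : G) : (x.act g).act h = x.act (g * h) := by
  induction x using Quotient.inductionOn' with
  | h a => exact congrArg Quotient.mk'' (mul_assoc a g h)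

/-- The permutation `x ↦ x h` of `Y \ G`. -/
def actEquiv (Y : Subgroup G) (h : G) : RightCosets Y ≃ RightCosets Y where
  toFun x := x.act h
  invFun x := x.act h⁻¹
  left_inv x := by
    change (x.act h).act h⁻¹ = x
    rw [act_act, mul_inv_cancel, act_one]
  right_inv x := by
    change (x.act h⁻¹).act h = x
    rw [act_act, inv_mul_cancel, act_one]

end RightCosets

/-- A section `t : Y \ G → G`, that is, a choice of an element `t (Y g) ∈ Y g` in each coset. -/
structure RightSection {G : Type*} [Group G] (Y : Subgroup G) where
  toFun : RightCosets Y → G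
  mk_toFun : ∀ x, (Quotient.mk'' (toFun x) : RightCosets Y) = x

namespace RightSection

variable {G : Type*} [Group G] {Y : Subgroup G} (t : RightSection Y)

/-- The element `y ∈ Y` determined by `t(x) h = y t(x h)`. -/
def factor (h : G) (x : RightCosets Y) : Y :=
  ⟨t.toFun x * h * (t.toFun (x.act h))⁻¹, by
    have e : (Quotient.mk'' (t.toFun (x.act h)) : RightCosets Y)
        = Quotient.mk'' (t.toFun x * h) := by
      rw [t.mk_toFun]
      conv_lhs => rw [← t.mk_toFun x]
      rfl
    exact QuotientGroup.rightRel_apply.1 (Quotient.exact' e)⟩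

instance : Nonempty (RightSection Y) := ⟨⟨Quotient.out, Quotient.out_eq'⟩⟩

theorem factor_one (x : RightCosets Y) : t.factor 1 x = 1 := by
  apply Subtype.ext
  simp [factor, RightCosets.act_one]

theorem factor_mul (g h : G) (x : RightCosets Y) :
    t.factor (g * h) x = t.factor g x * t.factor h (x.act g) := by
  apply Subtype.ext
  simp [factor, RightCosets.act_act, mul_assoc]

end RightSection

namespace UnitaryRep

open scoped ENNReal

variable {G : Type*} [Group G] {Y : Subgroup G} {W : Type*} [NormedAddCommGroup W]
  [InnerProductSpace ℂ W]

/-- The isometry `f ↦ (x ↦ β(y) f(x h))`, `t(x) h = y t(x h)`, of `L²(Y \ G, W)`. -/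
def inducedIsometry (t : RightSection Y) (β : UnitaryRep Y W) (h : G) :
    lp (fun _ : RightCosets Y => W) 2 →ₗᵢ[ℂ] lp (fun _ : RightCosets Y => W) 2 where
  toFun f := ⟨fun x => β (t.factor h x) (f (x.act h)), by
    have hf := (memℓp_gen_iff (by simp)).1 (lp.memℓp f)
    refine memℓp_gen ?_
    simp only [LinearIsometryEquiv.norm_map]
    exact (RightCosets.actEquiv Y h).summable_iff.2 hf⟩
  map_add' f g := by
    ext x
    exact map_add (β (t.factor h x)) _ _
  map_smul' c f := by
    ext x
    exact map_smul (β (t.factor h x)) _ _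
  norm_map' f := by
    rw [lp.norm_eq_tsum_rpow (by simp), lp.norm_eq_tsum_rpow (by simp) f]
    congr 1
    change ∑' x, ‖β (t.factor h x) (f (x.act h))‖ ^ (2 : ℝ≥0∞).toReal = _
    simp only [LinearIsometryEquiv.norm_map]
    exact (RightCosets.actEquiv Y h).tsum_eq (fun x => ‖f x‖ ^ (2 : ℝ≥0∞).toReal)

theorem inducedIsometry_apply (t : RightSection Y) (β : UnitaryRep Y W) (h : G)
    (f : lp (fun _ : RightCosets Y => W) 2) (x : RightCosets Y) :
    inducedIsometry t β h f x = β (t.factor h x) (f (x.act h)) := rfl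

theorem inducedIsometry_one (t : RightSection Y) (β : UnitaryRep Y W)
    (f : lp (fun _ : RightCosets Y => W) 2) : inducedIsometry t β 1 f = f := by
  ext x
  rw [inducedIsometry_apply, t.factor_one, map_one, RightCosets.act_one]
  rfl

theorem inducedIsometry_mul (t : RightSection Y) (β : UnitaryRep Y W) (g h : G)
    (f : lp (fun _ : RightCosets Y => W) 2) :
    inducedIsometry t β (g * h) f = inducedIsometry t β g (inducedIsometry t β h f) := by
  ext x
  simp only [inducedIsometry_apply]
  rw [t.factor_mul, map_mul, RightCosets.act_act]
  rfl

/-- The induced representation `Ind(G, Y, β)` on `L²(Y \ G, W)`, realized by means of a section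
`t : Y \ G → G`: `[ρ(h) f](x) = β(y) f(x h)`, where `y ∈ Y` is given by `t(x) h = y t(x h)`. -/
def induced (t : RightSection Y) (β : UnitaryRep Y W) :
    UnitaryRep G (lp (fun _ : RightCosets Y => W) 2) where
  toFun h := LinearIsometryEquiv.ofSurjective (inducedIsometry t β h) (fun f =>
    ⟨inducedIsometry t β h⁻¹ f, by
      rw [← inducedIsometry_mul, mul_inv_cancel, inducedIsometry_one]⟩)
  map_one' := by
    apply LinearIsometryEquiv.ext
    intro f
    exact inducedIsometry_one t β f
  map_mul' g h := by
    apply LinearIsometryEquiv.ext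
    intro f
    exact inducedIsometry_mul t β g h f

end UnitaryRep

namespace DiscreteHeisenberg

/-- The subgroup `Y = ℤ² ⋊ pℤ = {((m, k), s) : p ∣ s}`. -/
def stabilizer (p : ℕ) : Subgroup DiscreteHeisenberg where
  carrier := {g | (p : ℤ) ∣ g.s}
  one_mem' := dvd_zero _
  mul_mem' := fun ha hb => dvd_add ha hb
  inv_mem' := fun ha => (dvd_neg).2 ha

/-- The character `β((m, k), p s) = exp(2πi (m ξ + k q/p + s α))` of `ℤ² ⋊ pℤ`. -/
def stabilizerCharacter (p : ℕ) (q : ℕ) (ξ α : ℝ) : stabilizer p →* Circle where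
  toFun y := Circle.exp (2 * Real.pi *
    ((y.1.m : ℝ) * ξ + (y.1.k : ℝ) * ((q : ℝ) / p) + (y.1.s : ℝ) / p * α))
  map_one' := by simp
  map_mul' y z := by
    obtain ⟨n, hn⟩ : (p : ℤ) ∣ y.1.s := y.2
    have hs : (y.1.s : ℝ) = p * n := by exact_mod_cast hn
    rw [← Circle.exp_add, Circle.exp_eq_exp]
    rcases Nat.eq_zero_or_pos p with rfl | hp
    · refine ⟨0, ?_⟩
      simp
      ring
    · refine ⟨n * z.1.m * q, ?_⟩
      have hp' : (p : ℝ) ≠ 0 := by positivity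
      simp only [Subgroup.coe_mul, mul_m, mul_k, mul_s]
      push_cast
      rw [hs]
      field_simp
      ring

/-- The representation `ρ` of `H` has in the orthonormal basis `ε₀, …, ε_{p-1}` the explicit form
`ρ((m, k), s) ε_j = exp(2πi (m ξ + (k + j' m) η + [(s + j') / p] α)) ε_{j'}`, `j' = (j - s) mod p`.
Here `[·]` is the integer part; integer division by `p > 0` rounds down. -/
def HasExplicitForm {V : Type*} [NormedAddCommGroup V] [InnerProductSpace ℂ V] {p : ℕ}
    (ρ : UnitaryRep DiscreteHeisenberg V) (ξ η α : ℝ) (ε : OrthonormalBasis (Fin p) ℂ V) : Prop :=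
  ∀ (m k s : ℤ) (j j' : Fin p), ((j' : ℕ) : ℤ) = (((j : ℕ) : ℤ) - s) % (p : ℤ) →
    ρ ⟨m, k, s⟩ (ε j) =
      Complex.exp (2 * Real.pi * Complex.I *
        ((m * ξ + (k + (j' : ℕ) * m) * η + ((s + (j' : ℕ)) / (p : ℤ) : ℤ) * α : ℝ) : ℂ)) • ε j'

end DiscreteHeisenberg

end

/-!
Let `ρ` be irreducible of dimension `p`, and write `A = ρ(1,0,0)`, `Z = ρ(0,1,0)`, `B = ρ(0,0,1)`,
so that `Z` is central and `B A = Z A B`. By Schur's lemma `Z` is a scalar `z`, and taking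
determinants in this relation gives `z ^ p = 1`. Let `d` be the order of `z`. Then `B ^ d` commutes
with `A`, hence is a scalar `c`. If `v` is a unit eigenvector of `A` with eigenvalue `a`, the vectors
`B ^ (-j) v`, `0 ≤ j < d`, are eigenvectors of `A` with the distinct eigenvalues `a z ^ j`, hence
orthonormal, and `apply_orbit` computes the action of `H` on them. Their span is invariant, so they
form a basis and `d = p`. Writing `a`, `z`, `c` as `exp(2πi ξ)`, `exp(2πi q / p)`, `exp(2πi α)` gives
the explicit form (`exists_hasExplicitForm`).

Conversely, in a representation of explicit form, `Y = ℤ² ⋊ pℤ` acts on `ε₀` through the character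
`β` (`stabilizer_act_base`). For a section `t` the map `v ↦ (x ↦ ⟪ε₀, ρ(t(x)) v⟫)` therefore
intertwines `ρ` with the induced representation: `t(x) h = y t(x h)` lets `y` be moved to `ε₀`, where
it contributes `β(y)`. It is unitary because it is the coordinate map of the orthonormal basis
`ρ(t(x))⁻¹ ε₀`, whose members are unit multiples of the `ε_j` (`unitarilyEquivalent_induced`).

Finally the trace is read off in the basis `ε`: `ρ(m, k, s)` permutes the lines `ℂ ε_j` without fixed
lines unless `p ∣ s`, and for `p ∣ s` what remains is the geometric sum `∑ j, exp(2πi j m q / p)`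
(`character_eq`).
-/

/-! ### Phases -/

/-- The phase `exp(2πi x)`. -/
noncomputable def unitPhase (x : ℝ) : ℂ := Complex.exp (2 * Real.pi * Complex.I * (x : ℂ))

theorem unitPhase_eq_circleExp (x : ℝ) : unitPhase x = Circle.exp (2 * Real.pi * x) := by
  rw [unitPhase, Circle.coe_exp]
  congr 1
  push_cast
  ring

theorem unitPhase_add (x y : ℝ) : unitPhase (x + y) = unitPhase x * unitPhase y := by
  simp only [unitPhase, Complex.ofReal_add, mul_add, Complex.exp_add]

theorem unitPhase_int_mul (n : ℤ) (x : ℝ) : unitPhase (n * x) = unitPhase x ^ n := by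
  rw [unitPhase, unitPhase, ← Complex.exp_int_mul]
  congr 1
  push_cast
  ring

theorem unitPhase_int (n : ℤ) : unitPhase n = 1 := by
  rw [unitPhase, Complex.exp_eq_one_iff]
  exact ⟨n, by push_cast; ring⟩

theorem exists_unitPhase_eq {c : ℂ} (hc : ‖c‖ = 1) :
    ∃ x ∈ Set.Ico (0 : ℝ) 1, unitPhase x = c := by
  obtain ⟨θ, hθ⟩ := (Complex.norm_eq_one_iff c).1 hc
  refine ⟨Int.fract (θ / (2 * Real.pi)), ⟨Int.fract_nonneg _, Int.fract_lt_one _⟩, ?_⟩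
  have h : unitPhase (θ / (2 * Real.pi)) = c := by
    rw [unitPhase, ← hθ]
    congr 1
    have : (Real.pi : ℂ) ≠ 0 := by exact_mod_cast Real.pi_ne_zero
    push_cast
    field_simp
  rw [← Int.floor_add_fract (θ / (2 * Real.pi)), unitPhase_add, unitPhase_int, one_mul] at h
  exact h

theorem isPrimitiveRoot_unitPhase {p q : ℕ} (hp : 0 < p) (hq : q.Coprime p) :
    IsPrimitiveRoot (unitPhase ((q : ℝ) / p)) p := by
  have h := Complex.isPrimitiveRoot_exp_of_coprime q p hp.ne' hq
  simpa [unitPhase] using h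

/-! ### Irreducible unitary representations -/

namespace UnitaryRep

variable {G V : Type*} [Group G] [NormedAddCommGroup V] [InnerProductSpace ℂ V]

theorem toRepresentation_apply (ρ : UnitaryRep G V) (g : G) (v : V) :
    ρ.toRepresentation g v = ρ g v := rfl

theorem mul_apply (ρ : UnitaryRep G V) (g h : G) (v : V) : ρ (g * h) v = ρ g (ρ h v) := by
  rw [map_mul]; rfl

theorem inv_apply_apply (ρ : UnitaryRep G V) (g : G) (v : V) : ρ g⁻¹ (ρ g v) = v := by
  rw [← mul_apply, inv_mul_cancel, map_one]; rfl

theorem inner_inv_left (ρ : UnitaryRep G V) (g : G) (v w : V) :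
    inner ℂ (ρ g⁻¹ v) w = inner ℂ v (ρ g w) := by
  rw [← (ρ g).inner_map_map, ← mul_apply, mul_inv_cancel, map_one]; rfl

theorem zpow_apply_eq_smul (ρ : UnitaryRep G V) {g : G} {v : V} {c : ℂ} (hc : c ≠ 0)
    (h : ρ g v = c • v) (n : ℤ) : ρ (g ^ n) v = c ^ n • v := by
  have hinv : ρ g⁻¹ v = c⁻¹ • v := by
    rw [eq_inv_smul_iff₀ hc, ← map_smul, ← h, inv_apply_apply]
  induction n using Int.induction_on with
  | zero => rw [zpow_zero, map_one, zpow_zero, one_smul]; rfl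
  | succ n ih =>
    rw [zpow_add_one, mul_apply, h, map_smul, ih, smul_smul, zpow_add_one₀ hc, mul_comm]
  | pred n ih =>
    rw [zpow_sub_one, mul_apply, hinv, map_smul, ih, smul_smul, zpow_sub_one₀ hc, mul_comm]

theorem norm_eq_one_of_apply_eq_smul (ρ : UnitaryRep G V) {g : G} {v : V} {c : ℂ} (hv : v ≠ 0)
    (h : ρ g v = c • v) : ‖c‖ = 1 := by
  have h' := (ρ g).norm_map v
  rw [h, norm_smul] at h'
  exact mul_right_cancel₀ (norm_ne_zero_iff.2 hv) (h'.trans (one_mul _).symm)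

/-- Eigenvectors of a unitary operator for distinct eigenvalues are orthogonal. -/
theorem inner_eq_zero_of_apply_eq_smul (ρ : UnitaryRep G V) {g : G} {v w : V} {a b : ℂ}
    (ha : ‖a‖ = 1) (hab : a ≠ b) (hv : ρ g v = a • v) (hw : ρ g w = b • w) :
    inner ℂ v w = 0 := by
  have h := (ρ g).inner_map_map v w
  rw [hv, hw, inner_smul_left, inner_smul_right] at h
  by_contra h0
  have h1 : (starRingEnd ℂ) a * b = 1 := by
    apply mul_right_cancel₀ h0
    rw [one_mul, mul_assoc, h]
  have h2 : (starRingEnd ℂ) a * a = 1 := by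
    rw [mul_comm, Complex.mul_conj, Complex.normSq_eq_norm_sq, ha]; simp
  have h3 : (starRingEnd ℂ) a ≠ 0 := left_ne_zero_of_mul_eq_one h2
  exact hab (mul_left_cancel₀ h3 (h2.trans h1.symm))

/-- A nonzero invariant subspace of an irreducible representation is the whole space. -/
theorem eq_top_of_invariant (ρ : UnitaryRep G V) (hρ : ρ.toRepresentation.IsIrreducible)
    (W : Submodule ℂ V) (hW : ∀ g, ∀ w ∈ W, ρ g w ∈ W) (h0 : W ≠ ⊥) : W = ⊤ := by
  let S : Subrepresentation ρ.toRepresentation := ⟨W, fun g w hw => hW g w hw⟩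
  rcases hρ.eq_bot_or_eq_top S with h | h
  · exact absurd (congrArg Subrepresentation.toSubmodule h) h0
  · exact congrArg Subrepresentation.toSubmodule h

/-- Schur's lemma: in a finite-dimensional irreducible unitary representation, an operator of the
representation that commutes with all the others is scalar. -/
theorem exists_eq_smul_of_commute [FiniteDimensional ℂ V] [Nontrivial V] (ρ : UnitaryRep G V)
    (hρ : ρ.toRepresentation.IsIrreducible) (z : G)
    (hz : ∀ g v, ρ z (ρ g v) = ρ g (ρ z v)) : ∃ c : ℂ, ‖c‖ = 1 ∧ ∀ v, ρ z v = c • v := by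
  obtain ⟨c, hc⟩ := Module.End.exists_eigenvalue (ρ.toRepresentation z)
  have htop := ρ.eq_top_of_invariant hρ (Module.End.eigenspace (ρ.toRepresentation z) c)
    (fun g w hw => by
      rw [Module.End.mem_eigenspace_iff, toRepresentation_apply] at hw ⊢
      rw [hz, hw, map_smul]) hc
  have h : ∀ v, ρ z v = c • v := fun v =>
    Module.End.mem_eigenspace_iff.1 (htop ▸ Submodule.mem_top (x := v))
  obtain ⟨v, hv⟩ := exists_ne (0 : V)
  exact ⟨c, ρ.norm_eq_one_of_apply_eq_smul hv (h v), h⟩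

end UnitaryRep

namespace DiscreteHeisenberg

/-! ### Irreducible representations have the explicit form -/

theorem generatorM_zpow (n : ℤ) : (⟨1, 0, 0⟩ : DiscreteHeisenberg) ^ n = ⟨n, 0, 0⟩ := by
  induction n using Int.induction_on with
  | zero => rfl
  | succ n ih => rw [zpow_add_one, ih]; ext <;> simp
  | pred n ih => rw [zpow_sub_one, ih]; ext <;> simp; ring

theorem generatorK_zpow (n : ℤ) : (⟨0, 1, 0⟩ : DiscreteHeisenberg) ^ n = ⟨0, n, 0⟩ := by
  induction n using Int.induction_on with
  | zero => rfl
  | succ n ih => rw [zpow_add_one, ih]; ext <;> simp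
  | pred n ih => rw [zpow_sub_one, ih]; ext <;> simp; ring

theorem generatorS_zpow (n l : ℤ) : (⟨0, 0, n⟩ : DiscreteHeisenberg) ^ l = ⟨0, 0, n * l⟩ := by
  induction l using Int.induction_on with
  | zero => ext <;> simp
  | succ l ih => rw [zpow_add_one, ih]; ext <;> simp; ring
  | pred l ih => rw [zpow_sub_one, ih]; ext <;> simp; ring

variable {V : Type*} [NormedAddCommGroup V] [InnerProductSpace ℂ V]

/-- The action of `H` on the orbit `ρ(0, 0, -n) v` of an eigenvector `v` of `ρ(1, 0, 0)`, when
`ρ(0, 1, 0)` and `ρ(0, 0, d)` are scalars. -/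
theorem apply_orbit (ρ : UnitaryRep DiscreteHeisenberg V) {v : V} {a z c : ℂ} {d : ℤ}
    (ha : a ≠ 0) (hz : z ≠ 0) (hc : c ≠ 0) (hA : ρ ⟨1, 0, 0⟩ v = a • v)
    (hZ : ∀ w, ρ ⟨0, 1, 0⟩ w = z • w) (hB : ∀ w, ρ ⟨0, 0, d⟩ w = c • w)
    (m k s j j' l : ℤ) (h : j - s = j' - d * l) :
    ρ ⟨m, k, s⟩ (ρ ⟨0, 0, -j⟩ v) =
      (a ^ m * z ^ (k + j' * m) * c ^ l) • ρ ⟨0, 0, -j'⟩ v := by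
  -- Since `(1,0,0) (0,0,-j') = (0,j',0) (0,0,-j') (1,0,0)`, moving `(m,0,0)` past `(0,0,-j')` to the
  -- eigenvector costs the central factor `(0, j' m, 0)`.
  have e : (⟨m, k, s⟩ : DiscreteHeisenberg) * ⟨0, 0, -j⟩ =
      ⟨0, 1, 0⟩ ^ (k + j' * m) * (⟨0, 0, -j'⟩ * (⟨1, 0, 0⟩ ^ m * ⟨0, 0, d⟩ ^ l)) := by
    rw [generatorK_zpow, generatorM_zpow, generatorS_zpow]
    ext <;> simp
    linarith
  rw [← ρ.mul_apply, e, ρ.mul_apply, ρ.zpow_apply_eq_smul hz (hZ _), ρ.mul_apply, ρ.mul_apply,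
    ρ.zpow_apply_eq_smul hc (hB _), map_smul, ρ.zpow_apply_eq_smul ha hA, map_smul, map_smul,
    smul_smul, smul_smul]
  congr 1
  ring

/-- The scalar by which the centre acts is a root of unity whose order divides the dimension:
take determinants in `ρ(0,0,1) ρ(1,0,0) = ρ(0,1,0) ρ(1,0,0) ρ(0,0,1)`. -/
theorem central_scalar_pow_finrank (ρ : UnitaryRep DiscreteHeisenberg V)
    {z : ℂ} (hZ : ∀ w, ρ ⟨0, 1, 0⟩ w = z • w) : z ^ Module.finrank ℂ V = 1 := by
  have e : ρ.toRepresentation ⟨0, 0, 1⟩ * ρ.toRepresentation ⟨1, 0, 0⟩ =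
      z • (ρ.toRepresentation ⟨1, 0, 0⟩ * ρ.toRepresentation ⟨0, 0, 1⟩) := by
    ext w
    rw [← map_mul, ← map_mul, LinearMap.smul_apply, UnitaryRep.toRepresentation_apply,
      UnitaryRep.toRepresentation_apply, ← hZ, ← ρ.mul_apply]
    rfl
  have hdet := congrArg LinearMap.det e
  rw [LinearMap.det_smul, map_mul, map_mul] at hdet
  have hne : ∀ g, LinearMap.det (ρ.toRepresentation g) ≠ 0 := fun g =>
    (LinearEquiv.isUnit_det' (ρ g).toLinearEquiv).ne_zero
  have h := mul_ne_zero (hne ⟨1, 0, 0⟩) (hne ⟨0, 0, 1⟩)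
  apply mul_right_cancel₀ h
  rw [← hdet, one_mul, mul_comm]

/-- If `j'` is the residue of `j - s` modulo `p`, then the quotient of `j - s` by `p` is
`-[(s + j') / p]`. -/
theorem emod_reindex {p : ℕ} (hp : 0 < p) (s : ℤ) (j j' : Fin p)
    (h : ((j' : ℕ) : ℤ) = (((j : ℕ) : ℤ) - s) % (p : ℤ)) :
    ((j : ℕ) : ℤ) - s = ((j' : ℕ) : ℤ) - p * ((s + (j' : ℕ)) / (p : ℤ)) := by
  have hp' : (0 : ℤ) < p := by exact_mod_cast hp
  have h1 := Int.mul_ediv_add_emod (((j : ℕ) : ℤ) - s) p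
  have h2 : (s + ((j' : ℕ) : ℤ)) / (p : ℤ) = -((((j : ℕ) : ℤ) - s) / p) := by
    rw [Int.ediv_eq_iff_of_pos hp']
    have := j.2
    constructor <;> nlinarith
  rw [h2]
  linarith

theorem exists_index_eq_emod {p : ℕ} (hp : 0 < p) (n : ℤ) :
    ∃ j : Fin p, ((j : ℕ) : ℤ) = n % (p : ℤ) := by
  have hp' : (0 : ℤ) < p := by exact_mod_cast hp
  have h0 := Int.emod_nonneg n hp'.ne'
  have h1 := Int.emod_lt_of_pos n hp'
  exact ⟨⟨(n % p).toNat, by omega⟩, by simp [h0]⟩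

/-- An irreducible unitary representation of `H` has the explicit form in the orthonormal basis
`ρ(0, 0, -j) v`, `0 ≤ j < p`, where `v` is a unit eigenvector of `ρ(1, 0, 0)`. -/
theorem exists_hasExplicitForm [FiniteDimensional ℂ V] [Nontrivial V]
    (ρ : UnitaryRep DiscreteHeisenberg V) (hρ : ρ.toRepresentation.IsIrreducible)
    {p : ℕ} (hdim : Module.finrank ℂ V = p) :
    ∃ (ξ η α : ℝ) (q : ℕ) (ε : OrthonormalBasis (Fin p) ℂ V),
      ξ ∈ Set.Ico (0 : ℝ) 1 ∧ η ∈ Set.Ico (0 : ℝ) 1 ∧ α ∈ Set.Ico (0 : ℝ) 1 ∧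
      η = (q : ℝ) / p ∧ q.Coprime p ∧ HasExplicitForm ρ ξ η α ε := by
  obtain ⟨z, hz1, hZ⟩ := ρ.exists_eq_smul_of_commute hρ ⟨0, 1, 0⟩ fun g v => by
    rw [← ρ.mul_apply, ← ρ.mul_apply]
    congr 2
    ext <;> simp [add_comm]
  have hz0 : z ≠ 0 := norm_ne_zero_iff.1 (by rw [hz1]; exact one_ne_zero)
  obtain ⟨d, hd⟩ : ∃ d, d = orderOf z := ⟨_, rfl⟩
  have hprim : IsPrimitiveRoot z d := hd ▸ IsPrimitiveRoot.orderOf z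
  have hd0 : 0 < d := hd ▸ (isOfFinOrder_iff_pow_eq_one.2
    ⟨_, Module.finrank_pos, central_scalar_pow_finrank ρ hZ⟩).orderOf_pos
  obtain ⟨c, hc1, hB⟩ := ρ.exists_eq_smul_of_commute hρ ⟨0, 0, d⟩ fun g v => by
    -- `(0,0,d)` commutes with `g` up to the central element `(0, d m, 0)`, which acts by
    -- `z ^ (d m) = 1`.
    have e : (⟨0, 0, d⟩ : DiscreteHeisenberg) * g =
        ⟨0, 1, 0⟩ ^ ((d : ℤ) * g.m) * (g * ⟨0, 0, d⟩) := by
      rw [generatorK_zpow]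
      ext <;> simp [add_comm]
    rw [← ρ.mul_apply, ← ρ.mul_apply, e, ρ.mul_apply, ρ.zpow_apply_eq_smul hz0 (hZ _), zpow_mul,
      zpow_natCast, hprim.pow_eq_one, one_zpow, one_smul]
  have hc0 : c ≠ 0 := norm_ne_zero_iff.1 (by rw [hc1]; exact one_ne_zero)
  obtain ⟨v, a, hv, hA⟩ : ∃ (v : V) (a : ℂ), ‖v‖ = 1 ∧ ρ ⟨1, 0, 0⟩ v = a • v := by
    obtain ⟨a, ha⟩ := Module.End.exists_eigenvalue (ρ.toRepresentation ⟨1, 0, 0⟩)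
    obtain ⟨w, hw⟩ := ha.exists_hasEigenvector
    have hw' : ρ ⟨1, 0, 0⟩ w = a • w := hw.apply_eq_smul
    refine ⟨((‖w‖⁻¹ : ℝ) : ℂ) • w, a, ?_, by rw [map_smul, hw', smul_comm]⟩
    rw [norm_smul, Complex.norm_real, norm_inv, norm_norm,
      inv_mul_cancel₀ (norm_ne_zero_iff.2 hw.2)]
  have ha1 : ‖a‖ = 1 := ρ.norm_eq_one_of_apply_eq_smul (by rintro rfl; simp at hv) hA
  have ha0 : a ≠ 0 := norm_ne_zero_iff.1 (by rw [ha1]; exact one_ne_zero)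
  have hact := apply_orbit ρ ha0 hz0 hc0 hA hZ hB
  let e : Fin d → V := fun j => ρ ⟨0, 0, -((j : ℕ) : ℤ)⟩ v
  have hnorm : ∀ j, ‖e j‖ = 1 := fun j => by rw [LinearIsometryEquiv.norm_map, hv]
  have heig : ∀ j, ρ ⟨1, 0, 0⟩ (e j) = (a * z ^ (j : ℕ)) • e j := fun j => by
    simpa using hact 1 0 0 (j : ℕ) (j : ℕ) 0 (by ring)
  have horth : Orthonormal ℂ e := by
    refine ⟨hnorm, fun i j hij => ?_⟩
    refine ρ.inner_eq_zero_of_apply_eq_smul (by simp [ha1, hz1]) (fun h => hij ?_)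
      (heig i) (heig j)
    exact Fin.ext (hprim.pow_inj i.2 j.2 (mul_left_cancel₀ ha0 h))
  have hspan : Submodule.span ℂ (Set.range e) = ⊤ := by
    refine ρ.eq_top_of_invariant hρ _ (fun g w hw => ?_) ?_
    · induction hw using Submodule.span_induction with
      | mem x hx =>
        obtain ⟨j, rfl⟩ := hx
        obtain ⟨j', hj'⟩ := exists_index_eq_emod hd0 (((j : ℕ) : ℤ) - g.s)
        rw [show ρ g (e j) = _ from hact g.m g.k g.s _ _ _ (emod_reindex hd0 _ _ _ hj')]
        exact Submodule.smul_mem _ _ (Submodule.subset_span ⟨j', rfl⟩)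
      | zero => rw [map_zero]; exact Submodule.zero_mem _
      | add x y _ _ hx hy => rw [map_add]; exact Submodule.add_mem _ hx hy
      | smul r x _ hx => rw [map_smul]; exact Submodule.smul_mem _ _ hx
    · rw [Ne, Submodule.span_eq_bot]
      intro h
      have h' := hnorm ⟨0, hd0⟩
      rw [h _ ⟨_, rfl⟩, norm_zero] at h'
      exact zero_ne_one h'
  let ε : OrthonormalBasis (Fin d) ℂ V := OrthonormalBasis.mk horth hspan.ge
  have hε : ∀ j, ε j = ρ ⟨0, 0, -((j : ℕ) : ℤ)⟩ v := fun j => by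
    rw [OrthonormalBasis.coe_mk]
  -- The orbit is a basis of `V`, so the order of the central scalar is the dimension.
  obtain rfl : d = p := by
    rw [← hdim, Module.finrank_eq_card_basis ε.toBasis, Fintype.card_fin]
  obtain ⟨ξ, hξ, hξa⟩ := exists_unitPhase_eq ha1
  obtain ⟨α, hα, hαc⟩ := exists_unitPhase_eq hc1
  obtain ⟨q, hq, hqd, hqz⟩ := (Complex.isPrimitiveRoot_iff z d hd0.ne').1 hprim
  have hd' : (0 : ℝ) < d := by exact_mod_cast hd0
  have hη : unitPhase ((q : ℝ) / d) = z := by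
    rw [← hqz, unitPhase]; push_cast; rfl
  refine ⟨ξ, (q : ℝ) / d, α, q, ε, hξ, ⟨by positivity, ?_⟩, hα, rfl, hqd, ?_⟩
  · rw [div_lt_one hd']; exact_mod_cast hq
  intro m k s j j' hj
  rw [hε, hε, hact m k s _ _ _ (emod_reindex hd0 s j j' hj)]
  congr 1
  have hk : (k + (j' : ℕ) * m : ℝ) = ((k + (j' : ℕ) * m : ℤ) : ℝ) := by push_cast; rfl
  rw [← unitPhase, unitPhase_add, unitPhase_add, hk, unitPhase_int_mul, unitPhase_int_mul,
    unitPhase_int_mul, hξa, hη, hαc]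

/-! ### Equivalence with the induced representation -/

/-- The subgroup `Y = ℤ² ⋊ pℤ` acts on the first basis vector through the character `β`. -/
theorem stabilizer_act_base {p : ℕ} (hp : 0 < p) {ρ : UnitaryRep DiscreteHeisenberg V}
    {ξ α : ℝ} {q : ℕ} {ε : OrthonormalBasis (Fin p) ℂ V}
    (h : HasExplicitForm ρ ξ ((q : ℝ) / p) α ε) (y : stabilizer p) :
    ρ y (ε ⟨0, hp⟩) = (stabilizerCharacter p q ξ α y : ℂ) • ε ⟨0, hp⟩ := by
  obtain ⟨⟨m, k, s⟩, n, rfl : s = p * n⟩ := y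
  rw [h m k (p * n) ⟨0, hp⟩ ⟨0, hp⟩ (by simp), ← unitPhase, unitPhase_eq_circleExp]
  congr 2
  refine congrArg Circle.exp (congrArg (2 * Real.pi * ·) ?_)
  simp

/-- `ρ(m, k, s)⁻¹ ε₀` is a unit multiple of `ε_j`, where `j` is the residue of `s` mod `p`. -/
theorem inv_apply_base {p : ℕ} (hp : 0 < p) {ρ : UnitaryRep DiscreteHeisenberg V}
    {ξ η α : ℝ} {ε : OrthonormalBasis (Fin p) ℂ V}
    (h : HasExplicitForm ρ ξ η α ε) (g : DiscreteHeisenberg) (j : Fin p)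
    (hj : ((j : ℕ) : ℤ) = g.s % p) :
    ∃ c : ℂ, c ≠ 0 ∧ ρ g⁻¹ (ε ⟨0, hp⟩) = c • ε j :=
  ⟨_, Complex.exp_ne_zero _, h _ _ (-g.s) ⟨0, hp⟩ j (by simpa using hj)⟩

/-- The intertwiner is `v ↦ (x ↦ ⟪ε₀, ρ(t(x)) v⟫)`. -/
theorem unitarilyEquivalent_induced {p : ℕ} (hp : 0 < p) {ρ : UnitaryRep DiscreteHeisenberg V}
    {ξ α : ℝ} {q : ℕ} {ε : OrthonormalBasis (Fin p) ℂ V}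
    (h : HasExplicitForm ρ ξ ((q : ℝ) / p) α ε) (t : RightSection (stabilizer p)) :
    UnitaryRep.UnitarilyEquivalent ρ
      (UnitaryRep.induced t (UnitaryRep.ofCharacter (stabilizerCharacter p q ξ α))) := by
  have : FiniteDimensional ℂ V := ε.toBasis.finiteDimensional_of_finite
  let ε₀ := ε ⟨0, hp⟩
  let b : RightCosets (stabilizer p) → V := fun x => ρ (t.toFun x)⁻¹ ε₀
  have hb : ∀ x (j : Fin p), ((j : ℕ) : ℤ) = (t.toFun x).s % p → ∃ c : ℂ, c ≠ 0 ∧ b x = c • ε j :=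
    fun x j hj => inv_apply_base hp h _ j hj
  have horth : Orthonormal ℂ b := by
    refine ⟨fun x => by rw [LinearIsometryEquiv.norm_map]; exact ε.orthonormal.1 _,
      fun x y hxy => ?_⟩
    obtain ⟨i, hi⟩ := exists_index_eq_emod hp (t.toFun x).s
    obtain ⟨j, hj⟩ := exists_index_eq_emod hp (t.toFun y).s
    obtain ⟨c, -, hc⟩ := hb x i hi
    obtain ⟨c', -, hc'⟩ := hb y j hj
    have hij : i ≠ j := by
      rintro rfl
      apply hxy
      rw [← t.mk_toFun x, ← t.mk_toFun y]
      refine Quotient.sound' (QuotientGroup.rightRel_apply.2 ?_)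
      change (p : ℤ) ∣ (t.toFun y).s + -(t.toFun x).s
      exact Int.ModEq.dvd (n := p) (hi.symm.trans hj)
    rw [hc, hc', inner_smul_left, inner_smul_right, ε.orthonormal.2 hij, mul_zero, mul_zero]
  have hspan : ⊤ ≤ (Submodule.span ℂ (Set.range b)).topologicalClosure := by
    refine le_trans ?_ (Submodule.le_topologicalClosure _)
    rw [← ε.toBasis.span_eq, Submodule.span_le]
    rintro _ ⟨j, rfl⟩
    let x : RightCosets (stabilizer p) := Quotient.mk'' ⟨0, 0, (j : ℕ)⟩
    have hx : (p : ℤ) ∣ ((j : ℕ) : ℤ) + -(t.toFun x).s :=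
      QuotientGroup.rightRel_apply.1 (Quotient.exact' (t.mk_toFun x))
    obtain ⟨c, hc0, hc⟩ := hb x j (by
      rw [Int.ModEq.eq (Int.modEq_iff_dvd.2 hx)]
      exact (Int.emod_eq_of_lt (by positivity) (by exact_mod_cast j.2)).symm)
    rw [OrthonormalBasis.coe_toBasis, ← inv_smul_smul₀ hc0 (ε j), ← hc]
    exact Submodule.smul_mem _ _ (Submodule.subset_span ⟨x, rfl⟩)
  let B : HilbertBasis (RightCosets (stabilizer p)) ℂ V := HilbertBasis.mk horth hspan
  have hB : ∀ v x, B.repr v x = inner ℂ ε₀ (ρ (t.toFun x) v) := fun v x => by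
    rw [B.repr_apply_apply, HilbertBasis.coe_mk, ρ.inner_inv_left]
  refine ⟨B.repr, fun g v => ?_⟩
  ext x
  change _ = (stabilizerCharacter p q ξ α (t.factor g x) : ℂ) * B.repr v (x.act g)
  rw [hB, hB]
  have hfac : t.toFun x * g = (t.factor g x : DiscreteHeisenberg) * t.toFun (x.act g) := by
    simp [RightSection.factor]
  rw [← ρ.mul_apply, hfac, ρ.mul_apply, ← ρ.inner_inv_left, ← Subgroup.coe_inv,
    stabilizer_act_base hp h, inner_smul_left, map_inv, ← Circle.coe_inv_eq_conj, inv_inv]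

/-! ### The character -/

theorem sum_unitPhase_index {p q : ℕ} (hp : 0 < p) (hq : q.Coprime p) (m : ℤ) :
    ∑ j : Fin p, unitPhase (((j : ℕ) * m : ℤ) * ((q : ℝ) / p)) =
      if (p : ℤ) ∣ m then (p : ℂ) else 0 := by
  have hprim := isPrimitiveRoot_unitPhase hp hq
  have e : ∀ j : Fin p, unitPhase (((j : ℕ) * m : ℤ) * ((q : ℝ) / p)) =
      (unitPhase ((q : ℝ) / p) ^ m) ^ (j : ℕ) := fun j => by
    rw [unitPhase_int_mul, mul_comm, zpow_mul, zpow_natCast]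
  simp only [e]
  rw [Fin.sum_univ_eq_sum_range (fun j => (unitPhase ((q : ℝ) / p) ^ m) ^ j)]
  split_ifs with hm
  · simp [(hprim.zpow_eq_one_iff_dvd m).2 hm]
  · have hne : unitPhase ((q : ℝ) / p) ^ m ≠ 1 := fun h => hm ((hprim.zpow_eq_one_iff_dvd m).1 h)
    rw [geom_sum_eq hne, ← zpow_natCast, ← zpow_mul, mul_comm, zpow_mul, zpow_natCast,
      hprim.pow_eq_one, one_zpow, sub_self, zero_div]

theorem character_eq {p : ℕ} (hp : 0 < p) {ρ : UnitaryRep DiscreteHeisenberg V}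
    {ξ α : ℝ} {q : ℕ} (hq : q.Coprime p) {ε : OrthonormalBasis (Fin p) ℂ V}
    (h : HasExplicitForm ρ ξ ((q : ℝ) / p) α ε) (m k s : ℤ) :
    ρ.toRepresentation.character ⟨m, k, s⟩ =
      if (p : ℤ) ∣ s ∧ (p : ℤ) ∣ m then
        (p : ℂ) * unitPhase (m * ξ + k * ((q : ℝ) / p) + (s : ℝ) / p * α)
      else 0 := by
  have hp' : (p : ℝ) ≠ 0 := by positivity
  have hpz : (p : ℤ) ≠ 0 := by positivity
  rw [Representation.character, LinearMap.trace_eq_sum_inner _ ε]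
  simp only [UnitaryRep.toRepresentation_apply]
  by_cases hs : (p : ℤ) ∣ s
  · obtain ⟨n, rfl⟩ := hs
    have hterm : ∀ j, inner ℂ (ε j) (ρ ⟨m, k, p * n⟩ (ε j)) =
        unitPhase (m * ξ + k * ((q : ℝ) / p) + ((p * n : ℤ) : ℝ) / p * α) *
          unitPhase (((j : ℕ) * m : ℤ) * ((q : ℝ) / p)) := fun j => by
      have hj : ((j : ℕ) : ℤ) < p := by exact_mod_cast j.2
      have hdiv : (p * n + ((j : ℕ) : ℤ)) / (p : ℤ) = n := by
        rw [add_comm, Int.add_mul_ediv_left _ _ hpz, Int.ediv_eq_zero_of_lt (by positivity) hj,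
          zero_add]
      rw [h m k (p * n) j j (by
          rw [Int.sub_mul_emod_self_left, Int.emod_eq_of_lt (by positivity) hj]), hdiv,
        ← unitPhase, inner_smul_right, inner_self_eq_norm_sq_to_K, ε.orthonormal.1, ← unitPhase_add]
      simp only [RCLike.ofReal_one, one_pow, mul_one]
      congr 1
      push_cast
      field_simp
      ring
    rw [Finset.sum_congr rfl fun j _ => hterm j, ← Finset.mul_sum, sum_unitPhase_index hp hq]
    simp only [dvd_mul_right, true_and]
    split_ifs <;> ring
  · rw [if_neg fun h => hs h.1]
    refine Finset.sum_eq_zero fun j _ => ?_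
    obtain ⟨j', hj'⟩ := exists_index_eq_emod hp (((j : ℕ) : ℤ) - s)
    have hne : j ≠ j' := by
      rintro rfl
      have hs' : s = p * ((s + (j : ℕ)) / (p : ℤ)) := by linarith [emod_reindex hp s j j hj']
      exact hs ⟨_, hs'⟩
    rw [h m k s j j' hj', inner_smul_right, ε.orthonormal.2 hne, mul_zero]

end DiscreteHeisenberg

open DiscreteHeisenberg in
theorem lemma2 {V : Type*} [NormedAddCommGroup V] [InnerProductSpace ℂ V]
    (p : ℕ) (hp : 0 < p) (hdim : Module.finrank ℂ V = p) (ρ : UnitaryRep DiscreteHeisenberg V) :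
    -- an irreducible `ρ` has the explicit form, with parameters in the stated ranges
    (ρ.toRepresentation.IsIrreducible →
      ∃ (ξ η α : ℝ) (q : ℕ) (ε : OrthonormalBasis (Fin p) ℂ V),
        ξ ∈ Set.Ico (0 : ℝ) 1 ∧ η ∈ Set.Ico (0 : ℝ) 1 ∧ α ∈ Set.Ico (0 : ℝ) 1 ∧
        η = (q : ℝ) / p ∧ q.Coprime p ∧ HasExplicitForm ρ ξ η α ε) ∧
    -- a representation of this form is induced from `ℤ² ⋊ pℤ` and has the stated character
    (∀ (ξ η α : ℝ) (q : ℕ) (ε : OrthonormalBasis (Fin p) ℂ V),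
      ξ ∈ Set.Ico (0 : ℝ) 1 → η ∈ Set.Ico (0 : ℝ) 1 → α ∈ Set.Ico (0 : ℝ) 1 →
      η = (q : ℝ) / p → q.Coprime p → HasExplicitForm ρ ξ η α ε →
        (∀ t : RightSection (stabilizer p),
          UnitaryRep.UnitarilyEquivalent ρ
            (UnitaryRep.induced t (UnitaryRep.ofCharacter (stabilizerCharacter p q ξ α)))) ∧
        (∀ m k s : ℤ, ρ.toRepresentation.character ⟨m, k, s⟩ =
          if (p : ℤ) ∣ s ∧ (p : ℤ) ∣ m then
            (p : ℂ) * Complex.exp (2 * Real.pi * Complex.I *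
              ((m * ξ + k * η + (s : ℝ) / p * α : ℝ) : ℂ))
          else 0)) := by
  have : FiniteDimensional ℂ V := Module.finite_of_finrank_pos (hdim ▸ hp)
  have : Nontrivial V := Module.nontrivial_of_finrank_pos (R := ℂ) (hdim ▸ hp)
  refine ⟨fun hρ => exists_hasExplicitForm ρ hρ hdim, ?_⟩
  rintro ξ _ α q ε - - - rfl hq h
  exact ⟨unitarilyEquivalent_induced hp h, character_eq hp hq h⟩
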